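/- **Proposition (algebraic Poisson summation formula).** Let $k$ be a field. For an affine $k$-group $G=\operatorname{Spec}A_G$ let $A_G^*=\operatorname{Hom}_k(A_G,k)$ be the linear dual, with the algebra structure dual to the comultiplication of $A_G$. An *invariant integral* on $G$ is an element $w_G\in A_G^*$ with $w_G(1)=1$ and $w\cdot w_G=w(1)\,w_G=w_G\cdot w$ for all $w\in A_G^*$. If $w_G$ is an invariant integral on $G$, the *Fourier transform* is $F_G\colon A_G\to A_G^*$, $F_G(a)(b)=w_G(a^*b)$, where $a^*(g)=a(g^{-1})$. If $A_G^*=\prod_i A_i^*$ with finite-dimensional simple $k$-algebras $A_i^*$, then $tr_G=\sum_i tr_{A_i^*}$ denotes the trace on $\bigoplus_i A_i^*\subseteq A_G^*$, where $tr_{A_i^*}(b)$ is the trace of the $k$-linear endomorphism $b'\mapsto bb'$ of $A_i^*$. Let $G$ be semisimple, i.e. every linear representation of $G$ is completely reducible. Let $H\overset{i}{\hookrightarrow}G$ be a normal (closed) subgroup and $\pi\colon G\to G/H$ the quotient morphism, that is, the quotient map of affine groups with kernel $H$. Let $i^*\colon A_G\to A_H$ be the restriction morphism and $\pi\colon A_G^*\to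 A_{G/H}^*$ the algebra morphism induced by $\pi$, i.e. the transpose of $A_{G/H}\to A_G$. Then $G$ and $H$ each have a unique invariant integral, $w_G$ and $w_H$, and for every $a\in A_G$ the element $\pi(F_G(a))$ lies in the direct sum of the simple blocks of $A_{G/H}^*$ and $$w_H(i^*(a))=tr_{G/H}\bigl(\pi(F_G(a))\bigr).$$ -/

import Mathlib

open TensorProduct WithConv

universe u

namespace AffineGroup

/-! An affine `k`-group `G = Spec A` is given by its commutative Hopf algebra `A = A_G`. -/

noncomputable section

/-- A linear representation `E` of `G = Spec A`, given by its coaction `μ : E → E ⊗ A`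
(coassociative and counital). -/
structure IsRepresentation (k A : Type u) [Field k] [CommRing A] [HopfAlgebra k A]
    {E : Type u} [AddCommGroup E] [Module k E] (μ : E →ₗ[k] E ⊗[k] A) : Prop where
  coassoc : (TensorProduct.assoc k E A A).toLinearMap ∘ₗ LinearMap.rTensor A μ ∘ₗ μ =
    LinearMap.lTensor E (Coalgebra.comul (R := k) (A := A)) ∘ₗ μ
  counit : (TensorProduct.rid k E).toLinearMap ∘ₗ
    LinearMap.lTensor E (Coalgebra.counit (R := k) (A := A)) ∘ₗ μ = LinearMap.id

/-- `W ⊆ E` is a subrepresentation: `μ(W) ⊆ W ⊗ A`. -/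
def IsSubrepresentation {k A : Type u} [Field k] [CommRing A] [HopfAlgebra k A]
    {E : Type u} [AddCommGroup E] [Module k E] (μ : E →ₗ[k] E ⊗[k] A)
    (W : Submodule k E) : Prop :=
  W.map μ ≤ LinearMap.range (LinearMap.rTensor A W.subtype)

/-- `G = Spec A` is (linearly) semisimple, i.e. linearly reductive: every linear representation
is completely reducible. -/
def IsSemisimple (k A : Type u) [Field k] [CommRing A] [HopfAlgebra k A] : Prop :=
  ∀ (E : Type u) [AddCommGroup E] [Module k E] (μ : E →ₗ[k] E ⊗[k] A),
    IsRepresentation k A μ → ∀ W : Submodule k E, IsSubrepresentation μ W →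
      ∃ W' : Submodule k E, IsSubrepresentation μ W' ∧ IsCompl W W'

/-- The linear dual `A^*`. It carries Mathlib's convolution algebra structure
`(w * w')(a) = ∑ w(a₁) w'(a₂)`, which is the algebra structure on `A^*` that extends the
multiplication of points of `G`. -/
abbrev Dual (k A : Type u) [Field k] [CommRing A] [HopfAlgebra k A] : Type u :=
  WithConv (A →ₗ[k] k)

/-- `w ∈ A^*` is an invariant integral on `G`: `w(1) = 1`, and `w` is left and right
`G`-invariant, i.e. `w' * w = w'(1) w = w * w'` for all `w' ∈ A^*`. Equivalently `w` is the
element `(1, 0)` of a splitting `A^* = k × B^*` whose first projection is `w' ↦ w'(1)`. -/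
structure IsInvariantIntegral {k A : Type u} [Field k] [CommRing A] [HopfAlgebra k A]
    (w : Dual k A) : Prop where
  map_one : w 1 = 1
  left_invariant : ∀ w' : Dual k A, w' * w = w' 1 • w
  right_invariant : ∀ w' : Dual k A, w * w' = w' 1 • w

/-- The Fourier transform `F_G(a) = w(a^* · -)`, where `w` is the invariant integral and
`a^*(g) = a(g⁻¹)` is the antipode of `a`. -/
def fourierTransform {k A : Type u} [Field k] [CommRing A] [HopfAlgebra k A]
    (w : Dual k A) (a : A) : Dual k A :=
  toConv (w.ofConv ∘ₗ LinearMap.mulLeft k (HopfAlgebra.antipode k a))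

/-- The primitive central idempotents of an algebra `D`. When `D = ∏ᵢ Dᵢ` is a product of
simple algebras these are exactly the elements `1ᵢ = (0, …, 1, …, 0)`. -/
def IsBlockIdempotent {D : Type u} [Ring D] (e : D) : Prop :=
  e ≠ 0 ∧ e ∈ Subring.center D ∧ e * e = e ∧
    ∀ f ∈ Subring.center D, f * f = f → e * f = f → f = 0 ∨ f = e

/-- The block `Dᵢ = 1ᵢ D` of `D` cut out by `e = 1ᵢ`. -/
def block (k : Type u) {D : Type u} [Field k] [Ring D] [Algebra k D] (e : D) : Submodule k D :=
  LinearMap.range (LinearMap.mulLeft k e)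

/-- The sum `⊕ᵢ Dᵢ ⊆ D` of all blocks. For `D = A^*` this is the algebra `Ã` of functions on
the dual of `G`. -/
def blockSum (k D : Type u) [Field k] [Ring D] [Algebra k D] : Submodule k D :=
  ⨆ e : {e : D // IsBlockIdempotent e}, block k e.1

/-- The trace, on the block of `e`, of the endomorphism `x ↦ e w x`: this is `tr_{Dᵢ}(wᵢ)`, where
`tr_{Dᵢ}` is the trace of left multiplication on `Dᵢ` and `wᵢ = 1ᵢ w`. -/
def blockTrace (k : Type u) {D : Type u} [Field k] [Ring D] [Algebra k D] (e w : D) : k :=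
  LinearMap.trace k (block k e)
    ((LinearMap.mulLeft k e).rangeRestrict ∘ₗ LinearMap.mulLeft k w ∘ₗ (block k e).subtype)

/-- The trace `tr = ∑ᵢ tr_{Dᵢ}` on `⊕ᵢ Dᵢ` (elements of `⊕ᵢ Dᵢ` have finitely many nonzero
components). -/
def tr (k : Type u) {D : Type u} [Field k] [Ring D] [Algebra k D] (w : D) : k :=
  ∑ᶠ e : {e : D // IsBlockIdempotent e}, blockTrace k e.1 w

/-- The morphism `A_G^* → A_Q^*` induced by a morphism `G → Q`, given as `p : A_Q → A_G`. -/
def dualMap {k A AQ : Type u} [Field k] [CommRing A] [HopfAlgebra k A] [CommRing AQ]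
    [HopfAlgebra k AQ] (p : AQ →ₐc[k] A) (w : Dual k A) : Dual k AQ :=
  toConv (w.ofConv ∘ₗ (p : AQ →ₐ[k] A).toLinearMap)

/-- `H = Spec AH` is a normal subgroup of `G = Spec A` via `i^* : A → AH`: it is a closed subgroup,
and `g h g⁻¹ ∈ H(R)` for all commutative `k`-algebras `R`, `g ∈ G(R)`, `h ∈ H(R)`, where
`G(R) = Hom_{k-alg}(A, R)` with Mathlib's convolution product, and `g⁻¹` is the composite of `g`
with the antipode of `A`. -/
structure IsNormalSubgroup {k A AH : Type u} [Field k] [CommRing A] [HopfAlgebra k A]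
    [CommRing AH] [HopfAlgebra k AH] (i : A →ₐc[k] AH) : Prop where
  surjective : Function.Surjective i
  conj : ∀ (R : Type u) [CommRing R] [Algebra k R] (g : WithConv (A →ₐ[k] R)) (h : AH →ₐ[k] R),
    ∃ h' : AH →ₐ[k] R,
      g * toConv (h.comp (i : A →ₐ[k] AH)) * toConv (g.ofConv.comp (HopfAlgebra.antipodeAlgHom k A)) =
        toConv (h'.comp (i : A →ₐ[k] AH))

/-- `π : G → Q`, given by `p : A_Q → A_G`, is the quotient morphism of `G` by the subgroup `H`
(`i^* : A_G → A_H`): it is a quotient map of affine groups (`p` is injective), and its kernel, the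
fibre over the unit of `Q`, defined by the ideal generated by the image under `p` of the
augmentation ideal of `A_Q`, is `H`. So `1 → H → G → Q → 1` is exact and `Q = G/H`. -/
structure IsQuotientMorphism {k A AH AQ : Type u} [Field k] [CommRing A] [HopfAlgebra k A]
    [CommRing AH] [HopfAlgebra k AH] [CommRing AQ] [HopfAlgebra k AQ]
    (i : A →ₐc[k] AH) (p : AQ →ₐc[k] A) : Prop where
  injective : Function.Injective p
  ker_eq : RingHom.ker (i : A →ₐ[k] AH) =
    (RingHom.ker (Bialgebra.counitAlgHom k AQ)).map (p : AQ →ₐ[k] A)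

end

end AffineGroup

/-! Let B be the image of A_Q in A_G. It is a subcoalgebra, so complete reducibility of the regular
representation gives a central idempotent e of A_G^* whose translation a ↦ e·a projects A_G onto B
(`exists_central`); this is averaging over H. As B is a Hopf subalgebra, the projection is B-linear
(`actR_central_mul`). Hence e kills the ideal generated by p(ker ε), which is the kernel of i^*, and
it descends to the invariant integral of H: w_H(i^* a) = e(a) = ε(e·a).

On the other side F_G(a) e = F_G(e·a), and e acts as the identity on B, so π(F_G(a)) = F_Q(b) with
p(b) = e·a. What remains is the case of trivial H, namely tr F_Q(b) = ε(b) (`fourier_inversion`).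
Left multiplication by F(b) is the finite-rank operator x ↦ Σ x(b₁) F(b₂), supported on finitely
many finite-dimensional blocks, and its trace is Σ w(S(b₂) b₁) = ε(b) w(1). Blocks enter only
through their central idempotents, so no structure theory of simple algebras is needed. -/

namespace AffineGroup

noncomputable section

/-! ### Translations by functionals, subcoalgebras and central idempotents -/

section Translations

variable {k A : Type u} [Field k] [CommRing A] [HopfAlgebra k A]

/-- Left translation `a ↦ ∑ x(a₁) a₂` by a functional `x`. -/
def actL (x : Dual k A) : A →ₗ[k] A :=
  (TensorProduct.lid k A).toLinearMap ∘ₗ LinearMap.rTensor A x.ofConv ∘ₗ Coalgebra.comul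

/-- Right translation `a ↦ ∑ a₁ x(a₂)` by a functional `x`. -/
def actR (x : Dual k A) : A →ₗ[k] A :=
  (TensorProduct.rid k A).toLinearMap ∘ₗ LinearMap.lTensor A x.ofConv ∘ₗ Coalgebra.comul

theorem actL_eq_sum {ι : Type*} (x : Dual k A) {a : A} (r : Coalgebra.Repr k a ι) :
    actL x a = ∑ j ∈ r.index, x (r.left j) • r.right j := by
  simp [actL, ← r.eq]

theorem actR_eq_sum {ι : Type*} (x : Dual k A) {a : A} (r : Coalgebra.Repr k a ι) :
    actR x a = ∑ j ∈ r.index, x (r.right j) • r.left j := by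
  simp [actR, ← r.eq]

theorem mul_apply_eq_actL (x y : Dual k A) (a : A) : (x * y) a = y (actL x a) := by
  rw [(Coalgebra.Repr.arbitrary k a).convMul_apply, actL_eq_sum x (Coalgebra.Repr.arbitrary k a)]
  change _ = y.ofConv _
  rw [map_sum]
  exact Finset.sum_congr rfl fun j _ => by rw [map_smul]; rfl

theorem mul_apply_eq_actR (x y : Dual k A) (a : A) : (x * y) a = x (actR y a) := by
  rw [(Coalgebra.Repr.arbitrary k a).convMul_apply, actR_eq_sum y (Coalgebra.Repr.arbitrary k a)]
  change _ = x.ofConv _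
  rw [map_sum]
  exact Finset.sum_congr rfl fun j _ => by rw [map_smul, smul_eq_mul, mul_comm]

theorem eq_of_forall_dual {a b : A} (h : ∀ y : Dual k A, y a = y b) : a = b := by
  rw [← sub_eq_zero, ← Module.forall_dual_apply_eq_zero_iff k]
  intro f
  rw [map_sub, sub_eq_zero]
  exact h (toConv f)

theorem actL_mul (x y : Dual k A) (a : A) : actL (x * y) a = actL y (actL x a) :=
  eq_of_forall_dual fun z => by
    rw [← mul_apply_eq_actL, ← mul_apply_eq_actL, ← mul_apply_eq_actL, mul_assoc]

theorem actR_mul (x y : Dual k A) (a : A) : actR (x * y) a = actR x (actR y a) :=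
  eq_of_forall_dual fun z => by
    rw [← mul_apply_eq_actR, ← mul_apply_eq_actR, ← mul_apply_eq_actR, mul_assoc]

theorem actL_actR (x y : Dual k A) (a : A) : actL x (actR y a) = actR y (actL x a) :=
  eq_of_forall_dual fun z => by
    rw [← mul_apply_eq_actR, ← mul_apply_eq_actL, ← mul_apply_eq_actL, ← mul_apply_eq_actR,
      mul_assoc]

theorem one_dual_apply (a : A) : (1 : Dual k A) a = Coalgebra.counit (R := k) a := rfl

theorem counit_actL (x : Dual k A) (a : A) : Coalgebra.counit (R := k) (actL x a) = x a := by
  rw [← one_dual_apply, ← mul_apply_eq_actL, mul_one]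

theorem counit_actR (x : Dual k A) (a : A) : Coalgebra.counit (R := k) (actR x a) = x a := by
  rw [← one_dual_apply, ← mul_apply_eq_actR, one_mul]

theorem actL_dual_one (a : A) : actL (1 : Dual k A) a = a :=
  eq_of_forall_dual fun z => by rw [← mul_apply_eq_actL, one_mul]

theorem actR_dual_one (a : A) : actR (1 : Dual k A) a = a :=
  eq_of_forall_dual fun z => by rw [← mul_apply_eq_actR, mul_one]

theorem actL_one (x : Dual k A) : actL x (1 : A) = x 1 • 1 := by
  simp [actL, Algebra.TensorProduct.one_def]

theorem actR_one (x : Dual k A) : actR x (1 : A) = x 1 • 1 := by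
  simp [actR, Algebra.TensorProduct.one_def]

/-- A subspace stable under right translations, i.e. a subcomodule for the right regular
coaction. -/
def IsRightStable (V : Submodule k A) : Prop := ∀ x : Dual k A, ∀ v ∈ V, actR x v ∈ V

/-- A subspace stable under left translations. -/
def IsLeftStable (V : Submodule k A) : Prop := ∀ x : Dual k A, ∀ v ∈ V, actL x v ∈ V

theorem IsRightStable.isSubrepresentation {V : Submodule k A} (hV : IsRightStable V) :
    IsSubrepresentation (Coalgebra.comul (R := k) (A := A)) V := by
  rintro _ ⟨a, ha, rfl⟩
  let ℬ := Module.Basis.ofVectorSpace k A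
  obtain ⟨b, hb⟩ := TensorProduct.eq_repr_basis_right ℬ (Coalgebra.comul (R := k) a)
  -- The coefficients of Δ(a) in a basis of the second factor are the right translates of a by the
  -- coordinate functionals.
  have hmem : ∀ j, b j ∈ V := by
    intro j
    have h := hV (toConv (ℬ.coord j)) a ha
    have h2 : actR (toConv (ℬ.coord j)) a = b j := by
      simp only [actR, LinearMap.comp_apply, ← hb, Finsupp.sum, map_sum]
      rw [Finset.sum_eq_single j]
      · simp
      · intro l _ hl
        simp [Finsupp.single_eq_of_ne' hl]
      · intro hj
        simp [Finsupp.notMem_support_iff.mp hj]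
    rwa [h2] at h
  change Coalgebra.comul (R := k) a ∈ _
  rw [← hb]
  refine Submodule.sum_mem _ fun j _ => ⟨(⟨b j, hmem j⟩ : V) ⊗ₜ ℬ j, by simp⟩

theorem IsSubrepresentation.isRightStable {V : Submodule k A}
    (hV : IsSubrepresentation (Coalgebra.comul (R := k) (A := A)) V) : IsRightStable V := by
  intro x v hv
  obtain ⟨t, ht⟩ := hV ⟨v, hv, rfl⟩
  have : actR x v = (TensorProduct.rid k A) (LinearMap.lTensor A x.ofConv
      (LinearMap.rTensor A V.subtype t)) := by rw [ht]; rfl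
  rw [this]
  clear this ht
  induction t with
  | zero => simp
  | tmul m n => simpa using V.smul_mem _ m.2
  | add s t hs ht => simpa only [map_add] using V.add_mem hs ht

variable (k A) in
/-- Complete reducibility of the right regular representation. -/
def IsRegularSemisimple : Prop :=
  ∀ V : Submodule k A, IsRightStable V → ∃ W : Submodule k A, IsRightStable W ∧ IsCompl V W

theorem IsSemisimple.isRegularSemisimple (h : IsSemisimple k A) : IsRegularSemisimple k A := by
  intro V hV
  obtain ⟨W, hW, hc⟩ := h A (Coalgebra.comul (R := k) (A := A))
    ⟨Coalgebra.coassoc, by ext; simp⟩ V hV.isSubrepresentation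
  exact ⟨W, hW.isRightStable, hc⟩

/-- Every element lies in a finite-dimensional subcoalgebra. -/
theorem exists_finite_stable (b : A) : ∃ V : Submodule k A,
    b ∈ V ∧ IsRightStable V ∧ IsLeftStable V ∧ Module.Finite k V := by
  let S : Set A := {c | ∃ x y : Dual k A, actL x (actR y b) = c}
  refine ⟨Submodule.span k S, Submodule.subset_span ⟨1, 1, ?_⟩, ?_, ?_, ?_⟩
  · rw [actR_dual_one, actL_dual_one]
  · intro z v hv
    induction hv using Submodule.span_induction with
    | mem c hc =>
      obtain ⟨x, y, rfl⟩ := hc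
      refine Submodule.subset_span ⟨x, z * y, ?_⟩
      rw [actR_mul, ← actL_actR]
    | zero => simp
    | add c d _ _ hc hd => simpa only [map_add] using Submodule.add_mem _ hc hd
    | smul r c _ hc => simpa only [map_smul] using Submodule.smul_mem _ r hc
  · intro z v hv
    induction hv using Submodule.span_induction with
    | mem c hc =>
      obtain ⟨x, y, rfl⟩ := hc
      refine Submodule.subset_span ⟨x * z, y, ?_⟩
      rw [actL_mul]
    | zero => simp
    | add c d _ _ hc hd => simpa only [map_add] using Submodule.add_mem _ hc hd
    | smul r c _ hc => simpa only [map_smul] using Submodule.smul_mem _ r hc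
  -- Two-sided translates of b are combinations of the middle legs of one finite expansion of (Δ ⊗
  -- id)Δ(b).
  · let r := Coalgebra.Repr.arbitrary k b
    let q := fun j => Coalgebra.Repr.arbitrary k (r.left j)
    let T : Set A := ⋃ j ∈ r.index, (q j).right '' (q j).index
    have hT : T.Finite := r.index.finite_toSet.biUnion fun j _ =>
      (q j).index.finite_toSet.image _
    have hle : Submodule.span k S ≤ Submodule.span k T := by
      rw [Submodule.span_le]
      rintro _ ⟨x, y, rfl⟩
      rw [actR_eq_sum y r, map_sum]
      refine Submodule.sum_mem _ fun j hj => ?_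
      rw [map_smul, actL_eq_sum x (q j)]
      refine Submodule.smul_mem _ _ (Submodule.sum_mem _ fun l hl => Submodule.smul_mem _ _ ?_)
      exact Submodule.subset_span (Set.mem_biUnion hj ⟨l, hl, rfl⟩)
    have : Module.Finite k (Submodule.span k T) := FiniteDimensional.span_of_finite k hT
    exact Submodule.finiteDimensional_of_le hle

/-- Right-colinear maps into a subcoalgebra `V` that vanish on `V` are zero. -/
theorem IsRegularSemisimple.eq_zero_of_colinear (h : IsRegularSemisimple k A)
    {V : Submodule k A} (hL : IsLeftStable V) (f : A →ₗ[k] A)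
    (hf : ∀ (x : Dual k A) (a : A), f (actR x a) = actR x (f a)) (hfV : ∀ a, f a ∈ V)
    (hf0 : ∀ v ∈ V, f v = 0) : f = 0 := by
  obtain ⟨U, hU, hc⟩ := h (LinearMap.ker f) (fun x v hv => by
    rw [LinearMap.mem_ker] at hv ⊢
    rw [hf, hv, map_zero])
  have hinj : LinearMap.ker (f ∘ₗ U.subtype) = ⊥ := by
    rw [LinearMap.ker_eq_bot']
    intro u hu
    have : (u : A) ∈ LinearMap.ker f ⊓ U := ⟨hu, u.2⟩
    rw [hc.inf_eq_bot] at this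
    simpa using this
  obtain ⟨g, hg⟩ := LinearMap.exists_leftInverse_of_injective _ hinj
  -- On U the map f has a left inverse g. Composing g with the counit gives a functional whose left
  -- translation undoes f on U, so U lies in V by left stability, and there f vanishes.
  let θ : Dual k A := toConv (Coalgebra.counit ∘ₗ U.subtype ∘ₗ g)
  have hθ : ∀ u ∈ U, θ (f u) = Coalgebra.counit (R := k) u := by
    intro u hu
    have := LinearMap.congr_fun hg ⟨u, hu⟩
    change Coalgebra.counit (R := k) ((g (f u) : U) : A) = _
    simp only [LinearMap.comp_apply, Submodule.subtype_apply, LinearMap.id_apply] at this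
    rw [this]
  have hUV : U ≤ LinearMap.ker f := by
    intro u hu
    have hu' : actL θ (f u) = u := eq_of_forall_dual fun y => by
      rw [← mul_apply_eq_actL, mul_apply_eq_actR, ← hf, hθ _ (hU y u hu), counit_actR]
    rw [LinearMap.mem_ker, ← hu']
    exact hf0 _ (hL _ _ (hfV u))
  have : LinearMap.ker f = ⊤ := by
    rw [← hc.sup_eq_top, sup_eq_left.mpr hUV]
  exact LinearMap.ker_eq_top.mp this

theorem actL_eq_actR_of_central {e : Dual k A} (he : ∀ x, e * x = x * e) (a : A) :
    actL e a = actR e a :=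
  eq_of_forall_dual fun y => by rw [← mul_apply_eq_actL, he, mul_apply_eq_actR]

/-- A subcoalgebra `V` is cut out by a central idempotent of the dual, whose translation is the
projection onto `V`. -/
theorem IsRegularSemisimple.exists_central (h : IsRegularSemisimple k A)
    {V : Submodule k A} (hR : IsRightStable V) (hL : IsLeftStable V) :
    ∃ e : Dual k A, (∀ x, e * x = x * e) ∧ (∀ a, actR e a ∈ V) ∧ ∀ v ∈ V, actR e v = v := by
  obtain ⟨W, hW, hc⟩ := h V hR
  let P : A →ₗ[k] A := V.projection W hc
  have hPV : ∀ a, P a ∈ V := fun a => Submodule.projection_apply_mem hc a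
  have hPv : ∀ v ∈ V, P v = v := fun v hv => (Submodule.projection_eq_self_iff hc v).mpr hv
  have hPw : ∀ v ∈ W, P v = 0 := fun v hv =>
    (Submodule.projection_apply_eq_zero_iff hc).mpr hv
  have hPR : ∀ (x : Dual k A) (a : A), P (actR x a) = actR x (P a) := by
    intro x a
    obtain ⟨v, hv, w, hw, rfl⟩ : ∃ v ∈ V, ∃ w ∈ W, v + w = a :=
      Submodule.mem_sup.mp (hc.sup_eq_top ▸ Submodule.mem_top)
    rw [map_add, map_add, map_add, hPv v hv, hPw w hw, hPv _ (hR x v hv), hPw _ (hW x w hw)]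
    simp
  -- A right-colinear endomorphism is left translation by its composite with the counit.
  let e : Dual k A := toConv (Coalgebra.counit ∘ₗ P)
  have hPe : ∀ a, actL e a = P a := fun a => eq_of_forall_dual fun y => by
    rw [← mul_apply_eq_actL, mul_apply_eq_actR]
    change Coalgebra.counit (R := k) (P (actR y a)) = _
    rw [hPR, counit_actR]
  -- The commutator of P with a left translation is right-colinear, has values in V and kills V,
  -- hence vanishes. This is what makes e central.
  have hcomm : ∀ x : Dual k A, P ∘ₗ actL x - actL x ∘ₗ P = 0 := by
    intro x
    refine h.eq_zero_of_colinear hL _ ?_ ?_ ?_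
    · intro y a
      simp only [LinearMap.sub_apply, LinearMap.comp_apply, map_sub]
      rw [actL_actR, hPR, hPR, actL_actR]
    · intro a
      exact V.sub_mem (hPV _) (hL _ _ (hPV _))
    · intro v hv
      simp only [LinearMap.sub_apply, LinearMap.comp_apply]
      rw [hPv _ (hL x v hv), hPv v hv, sub_self]
  have hcen : ∀ x, e * x = x * e := by
    intro x
    ext a
    rw [mul_apply_eq_actL, mul_apply_eq_actL, hPe, ← counit_actL e, hPe, ← counit_actL x,
      ← sub_eq_zero, ← map_sub]
    have := LinearMap.congr_fun (hcomm x) a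
    simp only [LinearMap.sub_apply, LinearMap.comp_apply, LinearMap.zero_apply] at this
    rw [← neg_sub, this]
    simp
  refine ⟨e, hcen, fun a => ?_, fun v hv => ?_⟩
  · rw [← actL_eq_actR_of_central hcen, hPe]; exact hPV a
  · rw [← actL_eq_actR_of_central hcen, hPe]; exact hPv v hv

end Translations

/-! ### Invariant integrals and the Fourier transform -/

section Fourier

variable {k A : Type u} [Field k] [CommRing A] [HopfAlgebra k A]

-- In the convolution group of algebra maps A → A ⊗ A, Δ is the product of the two inclusions;
-- inverting reverses the order of the factors.
open HopfAlgebra in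
theorem comul_antipode (a : A) : Coalgebra.comul (R := k) (antipode k a) =
    TensorProduct.map (antipode k) (antipode k)
      (TensorProduct.comm k A A (Coalgebra.comul (R := k) a)) := by
  let j₁ : WithConv (A →ₐ[k] A ⊗[k] A) := toConv Algebra.TensorProduct.includeLeft
  let j₂ : WithConv (A →ₐ[k] A ⊗[k] A) := toConv Algebra.TensorProduct.includeRight
  let d : WithConv (A →ₐ[k] A ⊗[k] A) := toConv (Bialgebra.comulAlgHom k A)
  have hd : d = j₁ * j₂ := by
    ext a
    rw [AlgHom.convMul_apply]
    change Coalgebra.comul (R := k) a = _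
    conv_lhs => rw [← (Coalgebra.Repr.arbitrary k a).eq]
    conv_rhs => rw [← (Coalgebra.Repr.arbitrary k a).eq]
    rw [map_sum]
    refine Finset.sum_congr rfl fun i _ => ?_
    simp [j₁, j₂]
  have hinv : d⁻¹ = j₂⁻¹ * j₁⁻¹ := by
    rw [hd]
    exact mul_inv_rev (G := WithConv (A →ₐ[k] A ⊗[k] A)) j₁ j₂
  have h : (d⁻¹) a = (j₂⁻¹ * j₁⁻¹) a := by rw [hinv]
  rw [AlgHom.convMul_apply, ← (Coalgebra.Repr.arbitrary k a).eq, map_sum] at h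
  change Coalgebra.comul (R := k) (antipode k a) = _ at h
  rw [h, ← (Coalgebra.Repr.arbitrary k a).eq, map_sum, map_sum]
  refine Finset.sum_congr rfl fun i _ => ?_
  have h1 : ∀ x : A, (j₁⁻¹).ofConv x = antipode k x ⊗ₜ 1 := fun x => rfl
  have h2 : ∀ x : A, (j₂⁻¹).ofConv x = 1 ⊗ₜ antipode k x := fun x => rfl
  rw [Algebra.TensorProduct.lift_tmul, h1, h2]
  simp

/-- Both sides are the convolution inverse of p. -/
theorem map_antipode {B : Type u} [CommRing B] [HopfAlgebra k B] (p : B →ₐc[k] A) (b : B) :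
    p (HopfAlgebra.antipode k b) = HopfAlgebra.antipode k (p b) := by
  let f : WithConv (B →ₐ[k] A) := toConv (p : B →ₐ[k] A)
  let g : WithConv (B →ₐ[k] A) :=
    toConv ((HopfAlgebra.antipodeAlgHom k A).comp (p : B →ₐ[k] A))
  have hg : g * f = 1 := by
    have h := AlgHom.convMul_comp_bialgHom_distrib
      (toConv (HopfAlgebra.antipodeAlgHom k A)) (toConv (AlgHom.id k A)) p
    rw [AlgHom.antipode_id_cancel] at h
    apply WithConv.ofConv_injective
    refine Eq.trans h.symm ?_
    ext b
    change algebraMap k A (Coalgebra.counit (R := k) (p b)) =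
      algebraMap k A (Coalgebra.counit (R := k) b)
    rw [CoalgHomClass.counit_comp_apply]
  have : f⁻¹ b = g b := by rw [eq_inv_of_mul_eq_one_left hg]
  exact this

theorem fourierTransform_apply (w : Dual k A) (a c : A) :
    fourierTransform w a c = w (HopfAlgebra.antipode k a * c) := rfl

theorem IsInvariantIntegral.actL_eq {w : Dual k A} (hw : IsInvariantIntegral w) (a : A) :
    actL w a = w a • 1 :=
  eq_of_forall_dual fun y => by
    rw [← mul_apply_eq_actL, hw.right_invariant]
    change y 1 * w a = y.ofConv (w a • 1)
    rw [map_smul, smul_eq_mul, mul_comm]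

theorem IsInvariantIntegral.actR_eq {w : Dual k A} (hw : IsInvariantIntegral w) (a : A) :
    actR w a = w a • 1 :=
  eq_of_forall_dual fun y => by
    rw [← mul_apply_eq_actR, hw.left_invariant]
    change y 1 * w a = y.ofConv (w a • 1)
    rw [map_smul, smul_eq_mul, mul_comm]

theorem IsInvariantIntegral.eq {w w' : Dual k A} (hw : IsInvariantIntegral w)
    (hw' : IsInvariantIntegral w') : w = w' := by
  have h := hw.right_invariant w'
  rw [hw'.left_invariant, hw.map_one, hw'.map_one, one_smul, one_smul] at h
  exact h.symm

/-- The functional `b ↦ w(b^* c)`. -/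
def coFourier (w : Dual k A) (c : A) : Dual k A :=
  toConv (w.ofConv ∘ₗ LinearMap.mulRight k c ∘ₗ HopfAlgebra.antipode k)

theorem coFourier_apply (w : Dual k A) (a c : A) :
    coFourier w c a = w (HopfAlgebra.antipode k a * c) := rfl

/-- In Sweedler form, Σ w(S(b)c₁) c₂ = Σ b₁ w(S(b₂)c). Convolving the left side with S gives the
translate of S(b)c by w, which is w(S(b)c)·1 by invariance; convolving with the identity then
cancels S. -/
theorem IsInvariantIntegral.actL_fourierTransform {w : Dual k A} (hw : IsInvariantIntegral w)
    (b c : A) : actL (fourierTransform w b) c = actR (coFourier w c) b := by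
  let r := Coalgebra.Repr.arbitrary k c
  let u : WithConv (A →ₗ[k] A) := toConv (∑ j ∈ r.index,
    (w.ofConv ∘ₗ LinearMap.mulRight k (r.left j) ∘ₗ HopfAlgebra.antipode k).smulRight (r.right j))
  have hu : ∀ b, u b = actL (fourierTransform w b) c := by
    intro b
    rw [actL_eq_sum _ r]
    simp [u, fourierTransform_apply]
  let y : WithConv (A →ₗ[k] A) := toConv ((coFourier w c).ofConv.smulRight 1)
  have hSu : toConv (HopfAlgebra.antipode k) * u = y := by
    ext b
    let q := Coalgebra.Repr.arbitrary k b
    rw [q.convMul_apply]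
    change _ = w (HopfAlgebra.antipode k b * c) • (1 : A)
    rw [← hw.actL_eq]
    simp only [actL, LinearMap.comp_apply]
    rw [Bialgebra.comul_mul, comul_antipode, ← q.eq, ← r.eq]
    simp only [map_sum, TensorProduct.comm_tmul, TensorProduct.map_tmul, Finset.sum_mul_sum,
      Algebra.TensorProduct.tmul_mul_tmul, LinearMap.rTensor_tmul]
    refine Finset.sum_congr rfl fun i _ => ?_
    simp [u, Finset.mul_sum]
  have hid : u = toConv LinearMap.id * y := by
    rw [← hSu, ← mul_assoc, LinearMap.id_mul_antipode, one_mul]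
  rw [← hu, hid, (Coalgebra.Repr.arbitrary k b).convMul_apply,
    actR_eq_sum _ (Coalgebra.Repr.arbitrary k b)]
  simp [y]

theorem IsInvariantIntegral.actR_fourierTransform {w : Dual k A} (hw : IsInvariantIntegral w)
    (b c : A) : actR (fourierTransform w b) c = actL (coFourier w c) b := by
  let r := Coalgebra.Repr.arbitrary k c
  let u : WithConv (A →ₗ[k] A) := toConv (∑ j ∈ r.index,
    (w.ofConv ∘ₗ LinearMap.mulRight k (r.right j) ∘ₗ HopfAlgebra.antipode k).smulRight (r.left j))
  have hu : ∀ b, u b = actR (fourierTransform w b) c := by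
    intro b
    rw [actR_eq_sum _ r]
    simp [u, fourierTransform_apply]
  let y : WithConv (A →ₗ[k] A) := toConv ((coFourier w c).ofConv.smulRight 1)
  have hSu : u * toConv (HopfAlgebra.antipode k) = y := by
    ext b
    let q := Coalgebra.Repr.arbitrary k b
    rw [q.convMul_apply]
    change _ = w (HopfAlgebra.antipode k b * c) • (1 : A)
    rw [← hw.actR_eq]
    simp only [actR, LinearMap.comp_apply]
    rw [Bialgebra.comul_mul, comul_antipode, ← q.eq, ← r.eq]
    simp only [map_sum, TensorProduct.comm_tmul, TensorProduct.map_tmul, Finset.sum_mul_sum,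
      Algebra.TensorProduct.tmul_mul_tmul, LinearMap.lTensor_tmul]
    refine Finset.sum_congr rfl fun i _ => ?_
    simp [u, Finset.sum_mul]
    exact Finset.sum_congr rfl fun j _ => by rw [mul_comm (r.left j)]
  have hid : u = y * toConv LinearMap.id := by
    rw [← hSu, mul_assoc, LinearMap.antipode_mul_id, mul_one]
  rw [← hu, hid, (Coalgebra.Repr.arbitrary k b).convMul_apply,
    actL_eq_sum _ (Coalgebra.Repr.arbitrary k b)]
  simp [y]

/-- With its mirror image below, this makes the image of the Fourier transform a two-sided ideal,
with multiplication given by translation. -/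
theorem IsInvariantIntegral.fourierTransform_mul {w : Dual k A} (hw : IsInvariantIntegral w)
    (b : A) (x : Dual k A) : fourierTransform w b * x = fourierTransform w (actL x b) := by
  ext c
  rw [mul_apply_eq_actL, hw.actL_fourierTransform, ← mul_apply_eq_actR, mul_apply_eq_actL,
    coFourier_apply, fourierTransform_apply]

theorem IsInvariantIntegral.mul_fourierTransform {w : Dual k A} (hw : IsInvariantIntegral w)
    (b : A) (x : Dual k A) : x * fourierTransform w b = fourierTransform w (actR x b) := by
  ext c
  rw [mul_apply_eq_actR, hw.actR_fourierTransform, ← mul_apply_eq_actL, mul_apply_eq_actR,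
    coFourier_apply, fourierTransform_apply]

/-- The integral is the central idempotent of the subcoalgebra k·1. -/
theorem IsRegularSemisimple.exists_isInvariantIntegral (h : IsRegularSemisimple k A) :
    ∃ w : Dual k A, IsInvariantIntegral w := by
  have hR : IsRightStable (Submodule.span k {(1 : A)}) := by
    intro x v hv
    obtain ⟨r, rfl⟩ := Submodule.mem_span_singleton.mp hv
    rw [map_smul, actR_one, smul_smul]
    exact Submodule.smul_mem _ _ (Submodule.mem_span_singleton_self _)
  have hL : IsLeftStable (Submodule.span k {(1 : A)}) := by
    intro x v hv
    obtain ⟨r, rfl⟩ := Submodule.mem_span_singleton.mp hv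
    rw [map_smul, actL_one, smul_smul]
    exact Submodule.smul_mem _ _ (Submodule.mem_span_singleton_self _)
  obtain ⟨e, hcen, hmem, hfix⟩ := h.exists_central hR hL
  have h1 : ∀ w' : Dual k A, w' * e = w' 1 • e := by
    intro x
    ext a
    rw [mul_apply_eq_actR]
    obtain ⟨r, hr⟩ := Submodule.mem_span_singleton.mp (hmem a)
    have : e a = r := by rw [← counit_actR, ← hr]; simp
    change x.ofConv _ = x 1 * e a
    rw [← hr, this, map_smul, smul_eq_mul, mul_comm]
  refine ⟨e, ⟨?_, h1, fun x => by rw [hcen, h1]⟩⟩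
  rw [← counit_actR, hfix 1 (Submodule.mem_span_singleton_self _), Bialgebra.counit_one]

end Fourier

/-! ### Traces, blocks and primitive central idempotents -/

theorem trace_sum_smulRight {k M ι : Type*} [Field k] [AddCommGroup M] [Module k M]
    [Module.Finite k M] (s : Finset ι) (φ : ι → M →ₗ[k] k) (v : ι → M) :
    LinearMap.trace k M (∑ i ∈ s, (φ i).smulRight (v i)) = ∑ i ∈ s, φ i (v i) := by
  rw [map_sum]
  refine Finset.sum_congr rfl fun i _ => ?_
  have : (φ i).smulRight (v i) = dualTensorHom k M M (φ i ⊗ₜ v i) := by ext x; simp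
  rw [this, LinearMap.trace_eq_contract_apply, contractLeft_apply]

section Blocks

variable {k D : Type u} [Field k] [Ring D] [Algebra k D]

theorem mem_block_iff {e x : D} (he : e * e = e) : x ∈ block k e ↔ e * x = x := by
  constructor
  · rintro ⟨y, rfl⟩
    rw [LinearMap.mulLeft_apply, ← mul_assoc, he]
  · intro h
    exact ⟨x, h⟩

theorem block_le_block {e f : D} (h : e * f = f) : block k f ≤ block k e := by
  rintro _ ⟨y, rfl⟩
  exact ⟨f * y, by rw [LinearMap.mulLeft_apply, LinearMap.mulLeft_apply, ← mul_assoc, h]⟩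

theorem IsBlockIdempotent.eq_of_mul_ne_zero {e f : D} (he : IsBlockIdempotent e)
    (hf : IsBlockIdempotent f) (h : e * f ≠ 0) : e = f := by
  have hc : e * f = f * e := (Subring.mem_center_iff.mp he.2.1 f).symm
  have hcen : e * f ∈ Subring.center D := Subring.mul_mem _ he.2.1 hf.2.1
  have hidem : e * f * (e * f) = e * f := by
    rw [mul_assoc, ← mul_assoc f, ← hc, mul_assoc e f f, hf.2.2.1, ← mul_assoc, he.2.2.1]
  have h1 := (he.2.2.2 _ hcen hidem (by rw [← mul_assoc, he.2.2.1])).resolve_left h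
  have h2 := (hf.2.2.2 _ hcen hidem (by rw [hc, ← mul_assoc, hf.2.2.1])).resolve_left h
  exact h1.symm.trans h2

/-- A central idempotent with finite-dimensional block is a finite sum of primitive central
idempotents. -/
theorem exists_sum_blockIdempotents (e : D) (hc : e ∈ Subring.center D) (he : e * e = e)
    (hfin : Module.Finite k (block k e)) :
    ∃ s : Finset {e : D // IsBlockIdempotent e}, (∀ f ∈ s, e * f.1 = f.1) ∧ ∑ f ∈ s, f.1 = e := by
  classical
  induction hn : Module.finrank k (block k e) using Nat.strong_induction_on generalizing e with
  | _ n ih =>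
    subst hn
    by_cases h0 : e = 0
    · exact ⟨∅, by simp, by simp [h0]⟩
    by_cases hb : IsBlockIdempotent e
    · exact ⟨{⟨e, hb⟩}, by simpa using he, by simp⟩
    have hex : ∃ f ∈ Subring.center D, f * f = f ∧ e * f = f ∧ f ≠ 0 ∧ f ≠ e := by
      by_contra! hcon
      refine hb ⟨h0, hc, he, fun f hf hff hef => ?_⟩
      by_cases hf0 : f = 0
      · exact Or.inl hf0
      · exact Or.inr (hcon f hf hff hef hf0)
    have step : ∀ f ∈ Subring.center D, f * f = f → e * f = f → f ≠ e →
        ∃ s : Finset {e : D // IsBlockIdempotent e},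
          (∀ g ∈ s, f * g.1 = g.1) ∧ ∑ g ∈ s, g.1 = f := by
      intro f hf hff hef hfe
      have hle := block_le_block (k := k) hef
      have hlt : block k f < block k e := by
        refine lt_of_le_of_ne hle fun heq => hfe ?_
        have : e ∈ block k f := by rw [heq]; exact (mem_block_iff he).mpr he
        rw [mem_block_iff hff] at this
        rw [← hef, Subring.mem_center_iff.mp hf e, this]
      exact ih _ (Submodule.finrank_lt_finrank_of_lt hlt) f hf hff
        (Submodule.finiteDimensional_of_le hle) rfl
    obtain ⟨f, hf, hff, hef, hf0, hfe⟩ := hex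
    have hfe' : f * e = f := by rw [← Subring.mem_center_iff.mp hf e, hef]
    obtain ⟨s, hs, hsum⟩ := step f hf hff hef hfe
    obtain ⟨t, ht, htsum⟩ := step (e - f) (Subring.sub_mem _ hc hf)
      (by rw [mul_sub, sub_mul, sub_mul, he, hff, hef, hfe']; abel)
      (by rw [mul_sub, he, hef]) (by simpa using hf0)
    have hdisj : Disjoint s t := by
      rw [Finset.disjoint_left]
      intro g hgs hgt
      refine g.2.1 ?_
      rw [← hs g hgs, ← ht g hgt, ← mul_assoc, mul_sub, hfe', hff, sub_self, zero_mul]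
    refine ⟨s ∪ t, fun g hg => ?_, ?_⟩
    · rcases Finset.mem_union.mp hg with h | h
      · rw [← hs g h, ← mul_assoc, hef]
      · rw [← ht g h, ← mul_assoc, mul_sub, he, hef]
    · rw [Finset.sum_union hdisj, hsum, htsum]
      abel

theorem blockTrace_eq_trace {e w : D} (T : block k e →ₗ[k] block k e)
    (h : ∀ x, (T x : D) = e * (w * x)) : blockTrace k e w = LinearMap.trace k (block k e) T :=
  congrArg (LinearMap.trace k (block k e)) (LinearMap.ext fun x => Subtype.ext (h x).symm)

theorem blockTrace_eq_sum {e w : D} (hfin : Module.Finite k (block k e)) {ι : Type*}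
    (s : Finset ι) (φ : ι → D →ₗ[k] k) (v : ι → D) (h : ∀ x, w * x = ∑ i ∈ s, φ i x • v i) :
    blockTrace k e w = ∑ i ∈ s, φ i (e * v i) := by
  let u : ι → block k e := fun i => ⟨e * v i, ⟨_, rfl⟩⟩
  refine (blockTrace_eq_trace (∑ i ∈ s, (φ i ∘ₗ (block k e).subtype).smulRight (u i))
    fun x => ?_).trans (trace_sum_smulRight _ _ _)
  rw [LinearMap.sum_apply, AddSubmonoidClass.coe_finsetSum, h, Finset.mul_sum]
  exact Finset.sum_congr rfl fun i _ => (mul_smul_comm _ _ _).symm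

theorem finite_block_of_mul_eq {e f : D} (hfin : Module.Finite k (block k e)) (h : e * f = f) :
    Module.Finite k (block k f) :=
  Submodule.finiteDimensional_of_le (block_le_block h)

theorem finite_block {e : D} (he : e * e = e) {M : Type*} [AddCommGroup M] [Module k M]
    [Module.Finite k M] (g : D →ₗ[k] M) (hg : ∀ x, e * x = x → g x = 0 → x = 0) :
    Module.Finite k (block k e) := by
  refine Module.Finite.of_injective (g ∘ₗ (block k e).subtype) ?_
  rw [injective_iff_map_eq_zero]
  intro x hx
  exact Subtype.ext (hg x ((mem_block_iff he).mp x.2) hx)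

/-- A primitive idempotent outside s is orthogonal to every member of s, hence to e and to w, and
contributes nothing. -/
theorem tr_eq_sum {e w : D} (hew : e * w = w)
    {s : Finset {e : D // IsBlockIdempotent e}} (hs : ∑ f ∈ s, f.1 = e) :
    tr k w = ∑ f ∈ s, blockTrace k f.1 w := by
  refine finsum_eq_sum_of_support_subset _ fun f hf => ?_
  by_contra hfs
  refine hf ?_
  have hfe : f.1 * e = 0 := by
    rw [← hs, Finset.mul_sum]
    refine Finset.sum_eq_zero fun g hg => ?_
    by_contra h
    have := f.2.eq_of_mul_ne_zero g.2 h
    exact hfs (Subtype.ext this ▸ hg)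
  exact (blockTrace_eq_trace 0 fun x => by
    rw [← hew, mul_assoc e, ← mul_assoc f.1, hfe, zero_mul]; rfl).trans (map_zero _)

theorem mem_blockSum {e w : D} (hew : e * w = w)
    {s : Finset {e : D // IsBlockIdempotent e}} (hs : ∑ f ∈ s, f.1 = e) :
    w ∈ blockSum k D := by
  rw [← hew, ← hs, Finset.sum_mul]
  exact Submodule.sum_mem _ fun f _ => Submodule.mem_iSup_of_mem f ⟨w, rfl⟩

/-- The block of f contributes Σ φᵢ(f vᵢ), and the primitive idempotents f below e add up to e. -/
theorem tr_eq_sum_of_finiteRank {e w : D} (hc : e ∈ Subring.center D) (he : e * e = e)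
    (hew : e * w = w) (hfin : Module.Finite k (block k e)) {ι : Type*} (s : Finset ι)
    (φ : ι → D →ₗ[k] k) (v : ι → D) (h : ∀ x, w * x = ∑ i ∈ s, φ i x • v i) :
    w ∈ blockSum k D ∧ tr k w = ∑ i ∈ s, φ i (e * v i) := by
  obtain ⟨t, hte, ht⟩ := exists_sum_blockIdempotents e hc he hfin
  refine ⟨mem_blockSum hew ht, ?_⟩
  rw [tr_eq_sum hew ht, Finset.sum_congr rfl fun f hf =>
    blockTrace_eq_sum (finite_block_of_mul_eq hfin (hte f hf)) s φ v h, Finset.sum_comm]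
  refine Finset.sum_congr rfl fun i _ => ?_
  rw [← map_sum, ← Finset.sum_mul, ht]

theorem tr_zero : tr k (0 : D) = 0 := by
  simpa using tr_eq_sum (k := k) (e := (0 : D)) (w := 0) (s := ∅) (by simp)
    (by simp)

end Blocks

/-! ### Fourier inversion -/

section Inversion

variable {k A : Type u} [Field k] [CommRing A] [HopfAlgebra k A]

/-- The bilinear form `(a, c) ↦ w(c^* a)`. -/
def pairing (w : Dual k A) : A ⊗[k] A →ₗ[k] k :=
  w.ofConv ∘ₗ LinearMap.mul' k A ∘ₗ LinearMap.lTensor A (HopfAlgebra.antipode k)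

theorem pairing_tmul (w : Dual k A) (a c : A) :
    pairing w (a ⊗ₜ c) = w (HopfAlgebra.antipode k c * a) := by
  rw [mul_comm]
  simp [pairing]

theorem IsInvariantIntegral.pairing_comul {w : Dual k A} (hw : IsInvariantIntegral w) (b : A) :
    pairing w (Coalgebra.comul (R := k) b) = Coalgebra.counit (R := k) b := by
  simp only [pairing, LinearMap.comp_apply, HopfAlgebra.mul_antipode_lTensor_comul_apply]
  rw [Algebra.algebraMap_eq_smul_one, map_smul, hw.map_one, smul_eq_mul, mul_one]

/-- Fourier inversion at the unit element. -/
theorem IsRegularSemisimple.fourier_inversion (h : IsRegularSemisimple k A) {w : Dual k A}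
    (hw : IsInvariantIntegral w) (b : A) :
    fourierTransform w b ∈ blockSum k (Dual k A) ∧
      tr k (fourierTransform w b) = Coalgebra.counit (R := k) b := by
  obtain ⟨V, hb, hR, hL, hV⟩ := exists_finite_stable (k := k) b
  obtain ⟨e, hcen, hmem, hfix⟩ := h.exists_central hR hL
  have hc : e ∈ Subring.center (Dual k A) := Subring.mem_center_iff.mpr fun x => (hcen x).symm
  have hee : e * e = e := by
    ext a
    rw [mul_apply_eq_actR, ← counit_actR, hfix _ (hmem a), counit_actR]
  have hew : e * fourierTransform w b = fourierTransform w b := by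
    rw [hw.mul_fourierTransform, hfix b hb]
  have hfin : Module.Finite k (block k e) := by
    refine finite_block hee (M := V →ₗ[k] k)
      { toFun := fun x => x.ofConv ∘ₗ V.subtype, map_add' := fun _ _ => rfl,
        map_smul' := fun _ _ => rfl } fun x hx hx0 => ?_
    ext a
    rw [← hx, hcen, mul_apply_eq_actR]
    exact LinearMap.congr_fun hx0 ⟨actR e a, hmem a⟩
  let r := Coalgebra.Repr.arbitrary k b
  have hrank : ∀ x : Dual k A, fourierTransform w b * x =
      ∑ i ∈ r.index, x (r.left i) • fourierTransform w (r.right i) := by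
    intro x
    rw [hw.fourierTransform_mul, actL_eq_sum _ r]
    ext c
    rw [fourierTransform_apply]
    simp only [map_sum, map_smul, Finset.sum_mul, ofConv_sum, LinearMap.sum_apply]
    exact Finset.sum_congr rfl fun i _ => by rw [smul_mul_assoc, map_smul]; rfl
  obtain ⟨hmemb, hsum⟩ := tr_eq_sum_of_finiteRank hc hee hew hfin r.index
    (fun i => { toFun := fun x => x (r.left i), map_add' := fun _ _ => rfl,
                map_smul' := fun _ _ => rfl })
    (fun i => fourierTransform w (r.right i)) hrank
  refine ⟨hmemb, hsum.trans ?_⟩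
  -- The trace formula leaves a factor e acting on b₁. It can be dropped because Δ(b) lies in V ⊗ A
  -- and e fixes V.
  have hΔ : LinearMap.rTensor A (actL e) (Coalgebra.comul (R := k) b) =
      Coalgebra.comul (R := k) b := by
    obtain ⟨t, ht⟩ := hR.isSubrepresentation ⟨b, hb, rfl⟩
    rw [← ht, ← LinearMap.comp_apply, ← LinearMap.rTensor_comp]
    congr 2
    ext v
    rw [LinearMap.comp_apply, actL_eq_actR_of_central hcen]
    exact hfix _ v.2
  rw [← hw.pairing_comul b, ← hΔ, ← r.eq, map_sum, map_sum]
  refine Finset.sum_congr rfl fun i _ => ?_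
  rw [LinearMap.rTensor_tmul, pairing_tmul, ← fourierTransform_apply]
  exact mul_apply_eq_actL _ _ _

/-- Inversion applied to the translates of b recovers every y(b) as the trace of y * F(b). -/
theorem IsRegularSemisimple.fourierTransform_injective (h : IsRegularSemisimple k A)
    {w : Dual k A} (hw : IsInvariantIntegral w) {b : A} (hb : fourierTransform w b = 0) :
    b = 0 :=
  eq_of_forall_dual (k := k) fun y => by
    rw [← counit_actR, ← (h.fourier_inversion hw (actR y b)).2, ← hw.mul_fourierTransform, hb,
      mul_zero, tr_zero]
    exact (map_zero y.ofConv).symm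

end Inversion

/-! ### Quotient groups and averaging over the kernel -/

section Quotient

variable {k A AQ : Type u} [Field k] [CommRing A] [HopfAlgebra k A] [CommRing AQ]
  [HopfAlgebra k AQ]

theorem dualMap_apply (p : AQ →ₐc[k] A) (x : Dual k A) (b : AQ) : dualMap p x b = x (p b) := rfl

theorem actR_map (p : AQ →ₐc[k] A) (x : Dual k A) (b : AQ) :
    actR x (p b) = p (actR (dualMap p x) b) := by
  rw [actR_eq_sum _ (Coalgebra.Repr.arbitrary k b), map_sum]
  simp only [actR, LinearMap.comp_apply]
  rw [← CoalgHomClass.map_comp_comul_apply p b, ← (Coalgebra.Repr.arbitrary k b).eq]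
  simp [dualMap_apply]

theorem actL_map (p : AQ →ₐc[k] A) (x : Dual k A) (b : AQ) :
    actL x (p b) = p (actL (dualMap p x) b) := by
  rw [actL_eq_sum _ (Coalgebra.Repr.arbitrary k b), map_sum]
  simp only [actL, LinearMap.comp_apply]
  rw [← CoalgHomClass.map_comp_comul_apply p b, ← (Coalgebra.Repr.arbitrary k b).eq]
  simp [dualMap_apply]

theorem dualMap_surjective {p : AQ →ₐc[k] A} (hp : Function.Injective p) (y : Dual k AQ) :
    ∃ x : Dual k A, dualMap p x = y := by
  obtain ⟨g, hg⟩ := LinearMap.exists_leftInverse_of_injective (p : AQ →ₐ[k] A).toLinearMap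
    (LinearMap.ker_eq_bot.mpr hp)
  refine ⟨toConv (y.ofConv ∘ₗ g), ?_⟩
  ext b
  exact congrArg y.ofConv (LinearMap.congr_fun hg b)

/-- A complement is found inside A and pulled back along p; it stays stable because every functional
on A_Q extends to A. -/
theorem IsRegularSemisimple.of_injective (h : IsRegularSemisimple k A) {p : AQ →ₐc[k] A}
    (hp : Function.Injective p) : IsRegularSemisimple k AQ := by
  intro V hV
  let f : AQ →ₗ[k] A := (p : AQ →ₐ[k] A).toLinearMap
  obtain ⟨W, hW, hc⟩ := h (V.map f) (by
    rintro x _ ⟨v, hv, rfl⟩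
    exact ⟨_, hV (dualMap p x) v hv, (actR_map p x v).symm⟩)
  refine ⟨W.comap f, ?_, ?_⟩
  · intro y v hv
    obtain ⟨x, rfl⟩ := dualMap_surjective hp y
    change p _ ∈ W
    rw [← actR_map]
    exact hW x _ hv
  · constructor
    · rw [Submodule.disjoint_def]
      intro v hv hvW
      have := (Submodule.disjoint_def.mp hc.disjoint) (f v) ⟨v, hv, rfl⟩ hvW
      exact hp (this.trans (map_zero p).symm)
    · rw [codisjoint_iff, eq_top_iff]
      rintro q -
      obtain ⟨_, ⟨v, hv, rfl⟩, w, hw, hvw⟩ : ∃ v ∈ V.map f, ∃ w ∈ W, v + w = f q :=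
        Submodule.mem_sup.mp (hc.sup_eq_top ▸ Submodule.mem_top)
      refine Submodule.mem_sup.mpr ⟨v, hv, q - v, ?_, by abel⟩
      change f (q - v) ∈ W
      rw [map_sub, ← hvw, add_sub_cancel_left]
      exact hw

theorem IsInvariantIntegral.dualMap {w : Dual k A} (hw : IsInvariantIntegral w)
    {p : AQ →ₐc[k] A} (hp : Function.Injective p) : IsInvariantIntegral (dualMap p w) := by
  refine ⟨?_, fun y => ?_, fun y => ?_⟩
  · rw [dualMap_apply, _root_.map_one p, hw.map_one]
  · obtain ⟨x, rfl⟩ := dualMap_surjective hp y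
    ext b
    rw [mul_apply_eq_actL, dualMap_apply, ← actL_map, ← mul_apply_eq_actL, hw.left_invariant,
      dualMap_apply, _root_.map_one p]
    rfl
  · obtain ⟨x, rfl⟩ := dualMap_surjective hp y
    ext b
    rw [mul_apply_eq_actR, dualMap_apply, ← actR_map, ← mul_apply_eq_actR, hw.right_invariant,
      dualMap_apply, _root_.map_one p]
    rfl

theorem dualMap_fourierTransform (p : AQ →ₐc[k] A) (w : Dual k A) (b : AQ) :
    dualMap p (fourierTransform w (p b)) = fourierTransform (dualMap p w) b := by
  ext c
  rw [dualMap_apply, fourierTransform_apply, fourierTransform_apply, dualMap_apply, map_mul p,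
    map_antipode]

/-- The projection onto a Hopf subalgebra `V` is `V`-linear. -/
theorem IsRegularSemisimple.actR_central_mul (h : IsRegularSemisimple k A) {V : Submodule k A}
    {e : Dual k A} (hcen : ∀ x, e * x = x * e) (hmem : ∀ a, actR e a ∈ V)
    (hfix : ∀ v ∈ V, actR e v = v) (hmul : ∀ u ∈ V, ∀ v ∈ V, u * v ∈ V)
    (hS : ∀ v ∈ V, HopfAlgebra.antipode k v ∈ V) (a : A) {v : A} (hv : v ∈ V) :
    actR e (a * v) = actR e a * v := by
  obtain ⟨w, hw⟩ := h.exists_isInvariantIntegral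
  -- The kernel of the projection is orthogonal to V for the form w(S(a)b). Since S(cv)x =
  -- S(c)·(S(v)x) and V is closed under products and S, multiplying by v preserves orthogonality;
  -- injectivity of F concludes.
  have key : ∀ c : A, actR e c = 0 → actR e (c * v) = 0 := by
    intro c hc
    refine h.fourierTransform_injective hw ?_
    rw [← actL_eq_actR_of_central hcen, ← hw.fourierTransform_mul]
    ext x
    rw [mul_apply_eq_actR, fourierTransform_apply, HopfAlgebra.antipode_mul_distrib, mul_assoc,
      ← fourierTransform_apply, ← hfix _ (hmul _ (hS v hv) _ (hmem x)), ← mul_apply_eq_actR,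
      hw.fourierTransform_mul, actL_eq_actR_of_central hcen, hc, fourierTransform_apply,
      map_zero, zero_mul]
    exact map_zero w.ofConv
  have h0 := key (a - actR e a) (by rw [map_sub, hfix _ (hmem a), sub_self])
  rwa [sub_mul, map_sub, hfix _ (hmul _ (hmem a) _ hv), sub_eq_zero] at h0

/-- The central idempotent of `A_G^*` attached to a quotient `G → Q`; its translation averages
over the kernel. -/
theorem IsRegularSemisimple.exists_average (h : IsRegularSemisimple k A) (p : AQ →ₐc[k] A) :
    ∃ e : Dual k A, (∀ x, e * x = x * e) ∧ (∀ a, ∃ b, p b = actR e a) ∧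
      (∀ b, actR e (p b) = p b) ∧ ∀ a b, actR e (a * p b) = actR e a * p b := by
  let V : Submodule k A := LinearMap.range (p : AQ →ₐ[k] A).toLinearMap
  have hR : IsRightStable V := by
    rintro x _ ⟨b, rfl⟩
    exact ⟨_, (actR_map p x b).symm⟩
  have hL : IsLeftStable V := by
    rintro x _ ⟨b, rfl⟩
    exact ⟨_, (actL_map p x b).symm⟩
  obtain ⟨e, hcen, hmem, hfix⟩ := h.exists_central hR hL
  refine ⟨e, hcen, hmem, fun b => hfix _ ⟨b, rfl⟩, fun a b => ?_⟩
  refine h.actR_central_mul hcen hmem hfix ?_ ?_ a ⟨b, rfl⟩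
  · rintro _ ⟨b, rfl⟩ _ ⟨c, rfl⟩
    exact ⟨b * c, map_mul p b c⟩
  · rintro _ ⟨b, rfl⟩
    exact ⟨_, map_antipode p b⟩

variable {AH : Type u} [CommRing AH] [HopfAlgebra k AH]

theorem IsQuotientMorphism.map_map {i : A →ₐc[k] AH} {p : AQ →ₐc[k] A}
    (hp : IsQuotientMorphism i p) (b : AQ) :
    i (p b) = Coalgebra.counit (R := k) b • 1 := by
  have hb : b - algebraMap k AQ (Coalgebra.counit (R := k) b) ∈
      RingHom.ker (Bialgebra.counitAlgHom k AQ) := by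
    rw [RingHom.mem_ker, map_sub]
    simp
  have h : p (b - algebraMap k AQ (Coalgebra.counit (R := k) b)) ∈
      RingHom.ker (i : A →ₐ[k] AH) := by
    rw [hp.ker_eq]
    exact Ideal.mem_map_of_mem _ hb
  rw [RingHom.mem_ker] at h
  change i (p _) = 0 at h
  rw [map_sub, map_sub, sub_eq_zero] at h
  rw [h, Algebra.algebraMap_eq_smul_one, map_smul, map_smul, map_one, map_one]

/-- The kernel of a quotient morphism has an invariant integral, given by averaging. -/
theorem IsQuotientMorphism.exists_isInvariantIntegral {i : A →ₐc[k] AH} {p : AQ →ₐc[k] A}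
    (hp : IsQuotientMorphism i p) (hi : Function.Surjective i) {e : Dual k A}
    (hcen : ∀ x, e * x = x * e) (hmem : ∀ a, ∃ b, p b = actR e a)
    (hfix : ∀ b, actR e (p b) = p b) (hmul : ∀ a b, actR e (a * p b) = actR e a * p b) :
    ∃ w : Dual k AH, IsInvariantIntegral w ∧ ∀ a, w (i a) = e a := by
  -- The factor r is quantified after x so that the induction passes through multiples in the ideal.
  have hker : ∀ x ∈ (RingHom.ker (Bialgebra.counitAlgHom k AQ)).map (p : AQ →ₐ[k] A),
      ∀ r : A, e (r * x) = 0 := by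
    intro x hx
    induction hx using Submodule.span_induction with
    | mem x hx =>
      obtain ⟨b, hb, rfl⟩ := hx
      intro r
      rw [← counit_actR]
      change Coalgebra.counit (R := k) (actR e (r * p b)) = 0
      rw [hmul, Bialgebra.counit_mul, CoalgHomClass.counit_comp_apply p]
      exact mul_eq_zero_of_right _ hb
    | zero => exact fun r => by rw [mul_zero]; exact map_zero _
    | add x y _ _ hx hy => exact fun r => by rw [mul_add, map_add, hx, hy, add_zero]
    | smul s x _ hx => exact fun r => by rw [smul_eq_mul, ← mul_assoc]; exact hx _
  obtain ⟨w, hw⟩ : ∃ w : AH →ₗ[k] k, ∀ a, w (i a) = e a := by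
    obtain ⟨g, hg⟩ := LinearMap.exists_rightInverse_of_surjective (i : A →ₐ[k] AH).toLinearMap
      (LinearMap.range_eq_top.mpr hi)
    refine ⟨e.ofConv ∘ₗ g, fun a => ?_⟩
    have hmem : g (i a) - a ∈ RingHom.ker (i : A →ₐ[k] AH) := by
      rw [RingHom.mem_ker, map_sub, sub_eq_zero]
      exact LinearMap.congr_fun hg (i a)
    rw [hp.ker_eq] at hmem
    have h0 := hker _ hmem 1
    rw [one_mul, map_sub, sub_eq_zero] at h0
    exact h0
  -- The average of a comes from the quotient, so it is constant along H.
  have hie : ∀ a, i (actR e a) = e a • 1 := by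
    intro a
    obtain ⟨b, hb⟩ := hmem a
    rw [← counit_actR, ← hb, hp.map_map, CoalgHomClass.counit_comp_apply]
  refine ⟨toConv w, ⟨?_, fun y => ?_, fun y => ?_⟩, hw⟩
  · change w 1 = 1
    rw [← map_one i, hw, ← counit_actR, ← map_one p, hfix, map_one, Bialgebra.counit_one]
  · ext c
    obtain ⟨a, rfl⟩ := hi c
    have hd : dualMap i (toConv w) = e := by ext a; exact hw a
    rw [mul_apply_eq_actR, actR_map, hd, hie]
    change y.ofConv _ = y 1 * w (i a)
    rw [map_smul, hw, smul_eq_mul, mul_comm]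
  · ext c
    obtain ⟨a, rfl⟩ := hi c
    have hd : dualMap i (toConv w) = e := by ext a; exact hw a
    rw [mul_apply_eq_actL, actL_map, hd, actL_eq_actR_of_central hcen, hie]
    change y.ofConv _ = y 1 * w (i a)
    rw [map_smul, hw, smul_eq_mul, mul_comm]

end Quotient

end

end AffineGroup

/-! ### The Poisson summation formula -/

theorem mainTheorem6
    {k A AH AQ : Type u} [Field k]
    [CommRing A] [HopfAlgebra k A]
    [CommRing AH] [HopfAlgebra k AH]
    [CommRing AQ] [HopfAlgebra k AQ]
    (hG : AffineGroup.IsSemisimple k A)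
    (i : A →ₐc[k] AH) (hi : AffineGroup.IsNormalSubgroup i)
    (p : AQ →ₐc[k] A) (hp : AffineGroup.IsQuotientMorphism i p) :
    (∃! wG : AffineGroup.Dual k A, AffineGroup.IsInvariantIntegral wG) ∧
    (∃! wH : AffineGroup.Dual k AH, AffineGroup.IsInvariantIntegral wH) ∧
    ∀ (wG : AffineGroup.Dual k A) (wH : AffineGroup.Dual k AH),
      AffineGroup.IsInvariantIntegral wG → AffineGroup.IsInvariantIntegral wH →
      ∀ a : A,
        AffineGroup.dualMap p (AffineGroup.fourierTransform wG a) ∈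
          AffineGroup.blockSum k (AffineGroup.Dual k AQ) ∧
        wH (i a) =
          AffineGroup.tr k (AffineGroup.dualMap p (AffineGroup.fourierTransform wG a)) := by
  have h := hG.isRegularSemisimple
  obtain ⟨e, hcen, hmem, hfix, hmul⟩ := h.exists_average p
  obtain ⟨w, hw⟩ := h.exists_isInvariantIntegral
  obtain ⟨v, hv, hve⟩ := hp.exists_isInvariantIntegral hi.surjective hcen hmem hfix hmul
  refine ⟨⟨w, hw, fun w' hw' => hw'.eq hw⟩, ⟨v, hv, fun v' hv' => hv'.eq hv⟩, ?_⟩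
  intro wG wH hwG hwH a
  rw [hwH.eq hv, hve]
  obtain ⟨b, hb⟩ := hmem a
  -- Replacing a by its average multiplies F_G(a) by e, which is invisible after restriction to the
  -- image of p.
  have hF : AffineGroup.dualMap p (AffineGroup.fourierTransform wG a) =
      AffineGroup.fourierTransform (AffineGroup.dualMap p wG) b := by
    rw [← AffineGroup.dualMap_fourierTransform, hb, ← AffineGroup.actL_eq_actR_of_central hcen,
      ← hwG.fourierTransform_mul]
    ext c
    rw [AffineGroup.dualMap_apply, AffineGroup.dualMap_apply, AffineGroup.mul_apply_eq_actR, hfix]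
  rw [hF]
  obtain ⟨h1, h2⟩ :=
    (h.of_injective hp.injective).fourier_inversion (hwG.dualMap hp.injective) b
  refine ⟨h1, ?_⟩
  rw [h2, ← AffineGroup.counit_actR, ← hb, CoalgHomClass.counit_comp_apply]
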